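/- Let $a,b\neq 1$ be square-free integers with $ab$ not a square, put $g=\gcd(a,b)$ and $c=ab/g^2$, and let $F=\mathbb{Q}(\sqrt a,\sqrt b)$, with quadratic subfields $F_1=\mathbb{Q}(\sqrt a)$, $F_2=\mathbb{Q}(\sqrt b)$, $F_3=\mathbb{Q}(\sqrt c)$, where the square root of $c$ is chosen as $\sqrt c=\sqrt a\sqrt b/g$. For $i=1,2$ let $\sigma_i$ be the nontrivial automorphism of $F$ that is the identity on $F_i$. Let $S=s_0+s_1\sqrt a+s_2\sqrt b+s_3\sqrt c\neq 0$ with $s_0,s_1,s_2,s_3\in\mathbb{Z}$. Let $p\equiv 3\pmod 4$ be a prime number dividing $N_{F/\mathbb{Q}}(S)$ such that the Legendre symbols satisfy $\left(\frac ap\right)=\left(\frac bp\right)=\left(\frac cp\right)=1$. Let $A,B,C$ be integers with $A^2\equiv a$, $B^2\equiv b$, $C^2\equiv c$ and $Cg\equiv AB\pmod p$. Then there are exactly four prime ideals $\mathcal{P}$ of $O_F$ above $p$, the ideals $$\mathfrak{p}_{11}=(p,\sqrt a-A),\ \mathfrak{p}_{12}=(p,\sqrt a+A)\subset O_{F_1},\qquad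 \mathfrak{p}_{21}=(p,\sqrt b-B),\ \mathfrak{p}_{22}=(p,\sqrt b+B)\subset O_{F_2},\qquad \mathfrak{p}_{31}=(p,\sqrt c-C),\ \mathfrak{p}_{32}=(p,\sqrt c+C)\subset O_{F_3}$$ are nonzero prime ideals, and $S\sigma_1(S)\in F_1$, $S\sigma_2(S)\in F_2$, $\sigma_1(S)\sigma_2(S)\in F_3$. Moreover, the Hilbert symbol $\left(\frac{-1,S}{\mathcal{P}}\right)$ over the completion $F_{\mathcal P}$ equals $1$ for all four prime ideals $\mathcal{P}$ above $p$ if and only if the four integers $$v_{\mathfrak{p}_{11}}(S\sigma_1(S))+v_{\mathfrak{p}_{21}}(S\sigma_2(S))-v_{\mathfrak{p}_{31}}(\sigma_1(S)\sigma_2(S)),$$ $$v_{\mathfrak{p}_{11}}(S\sigma_1(S))+v_{\mathfrak{p}_{22}}(S\sigma_2(S))-v_{\mathfrak{p}_{32}}(\sigma_1(S)\sigma_2(S)),$$ $$v_{\mathfrak{p}_{12}}(S\sigma_1(S))+v_{\mathfrak{p}_{21}}(S\sigma_2(S))-v_{\mathfrak{p}_{32}}(\sigma_1(S)\sigma_2(S)),$$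 $$v_{\mathfrak{p}_{12}}(S\sigma_1(S))+v_{\mathfrak{p}_{22}}(S\sigma_2(S))-v_{\mathfrak{p}_{31}}(\sigma_1(S)\sigma_2(S))$$ are all divisible by $4$, where $v_{\mathfrak{p}}$ denotes the $\mathfrak{p}$-adic additive valuation. -/

import Mathlib

open IsDedekindDomain NumberField
open scoped IntermediateField

open Classical in
/-- The Hilbert symbol `(u, w)` over a field `K` (meant for a local field of characteristic
different from `2` and nonzero `u`, `w`): it is `1` if `z² = u x² + w y²` has a solution
`(x, y, z) ≠ (0, 0, 0)` in `K`, and `-1` otherwise. -/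
noncomputable def hilbertSymbol (K : Type*) [Field K] (u w : K) : ℤ :=
  if ∃ x y z : K, (x, y, z) ≠ (0, 0, 0) ∧ z ^ 2 = u * x ^ 2 + w * y ^ 2 then 1 else -1

/-- The additive valuation `v_𝔭 : Kˣ → ℤ` at a nonzero prime ideal `𝔭` of the ring of integers
of a number field `K` (with the convention `v_𝔭(0) = 0`). Mathlib's `𝔭.valuation K` is
multiplicative: its value at `x ≠ 0` is the element of `ℤᵐ⁰` with logarithm `-v_𝔭(x)`. -/
noncomputable def ordAt {K : Type*} [Field K] [NumberField K]
    (𝔭 : HeightOneSpectrum (𝓞 K)) (x : K) : ℤ :=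
  -WithZero.log (𝔭.valuation K x)

/-! Local part: let `P` be a place with residue field of prime order `p ≡ 3 mod 4`. Since `-1` is
not a square modulo `p`, the form `z² + x²` is anisotropic over the residue field, so its nonzero
values at `P` have even valuation. Conversely, every local unit is a sum of two squares: this holds
in `ZMod p` and lifts, because local units congruent to `1` are squares. Hence `(-1, S)` is trivial
at `P` exactly when `v_P(S)` is even (`hilbertSymbol_neg_one_eq_one_iff`).

Global part: conjugation produces a place of `F` above `p` for each choice of residues `±A`, `±B` of
`√a`, `√b`. These four places are distinct because `p` does not divide `2A` or `2B`. As `[F : ℚ] ≤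
4`, comparing norms shows that they are all the places above `p`, unramified and of degree one
(`prod_asIdeal_eq_span` and its consequences). So `v_P` restricts to the valuation of the prime
below it in each quadratic subfield, and the congruence `Cg ≡ AB` tells which prime of `F₃` that is.

Finally `v_P(Sσ₁S) + v_P(Sσ₂S) - v_P(σ₁Sσ₂S) = 2 v_P(S)`, which is divisible by `4` exactly when
`v_P(S)` is even. -/

/-- In a complete ultrametric field in which `2` is a unit, every `w` with `‖w - 1‖ < 1`
is a square. -/
theorem exists_sq_eq_of_norm_sub_one_lt_one {K : Type*} [NormedField K] [IsUltrametricDist K]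
    [CompleteSpace K] (h2 : ‖(2 : K)‖ = 1) {w : K} (hw : ‖w - 1‖ < 1) : ∃ t : K, t ^ 2 = w := by
  have h20 : (2 : K) ≠ 0 := by
    intro h
    simp [h] at h2
  set r : NNReal := ‖w - 1‖₊ with hr
  -- Newton iteration for `t² - w` with the derivative frozen at its value `2` at `t = 1`. It
  -- contracts the ball of radius `‖w - 1‖` around `1` with that same ratio.
  let f : K → K := fun t => t - (t ^ 2 - w) / 2
  let s : Set K := Metric.closedBall 1 ‖w - 1‖
  have hs : IsComplete s := Metric.isClosed_closedBall.isComplete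
  have hmem : ∀ t, t ∈ s ↔ ‖t - 1‖ ≤ ‖w - 1‖ := fun t => by
    simp [s, Metric.mem_closedBall, dist_eq_norm]
  have hmap : Set.MapsTo f s s := by
    intro t ht
    rw [hmem] at ht ⊢
    have e : f t - 1 = (w - 1) / 2 + -((t - 1) ^ 2 / 2) := by
      simp only [f]
      field_simp
      ring
    rw [e]
    refine (IsUltrametricDist.norm_add_le_max _ _).trans (max_le ?_ ?_)
    · rw [norm_div, h2, div_one]
    · rw [norm_neg, norm_div, h2, div_one, norm_pow]
      nlinarith [norm_nonneg (t - 1)]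
  have hf : ContractingWith r (hmap.restrict f s s) := by
    refine ⟨by exact_mod_cast hw, LipschitzWith.of_dist_le_mul ?_⟩
    rintro ⟨x, hx⟩ ⟨y, hy⟩
    rw [Subtype.dist_eq, Subtype.dist_eq]
    simp only [Set.MapsTo.val_restrict_apply, dist_eq_norm]
    rw [hmem] at hx hy
    have e : f x - f y = ((1 - x) + (1 - y)) / 2 * (x - y) := by
      simp only [f]
      field_simp
      ring
    rw [e, norm_mul, norm_div, h2, div_one]
    refine mul_le_mul_of_nonneg_right ?_ (norm_nonneg _)
    refine (IsUltrametricDist.norm_add_le_max _ _).trans (max_le ?_ ?_)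
    · rw [norm_sub_rev]; exact hx
    · rw [norm_sub_rev]; exact hy
  obtain ⟨t, -, ht, -⟩ := hf.exists_fixedPoint' hs hmap
    ((hmem 1).2 (by simp)) (edist_ne_top _ _)
  refine ⟨t, ?_⟩
  have : t - (t ^ 2 - w) / 2 = t := ht
  field_simp at this
  linear_combination -this

/-! ### Residues and squares at places of a number field -/

section Places

variable {K : Type*} [Field K] [NumberField K]

/-- A quotient with `p` elements has cyclic additive group, generated by `1`. -/
theorem exists_int_sub_mem_of_absNorm_eq (I : Ideal (𝓞 K)) (p : ℕ) [Fact p.Prime]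
    (hN : Ideal.absNorm I = p) (x : 𝓞 K) : ∃ n : ℤ, x - n ∈ I := by
  have hcard : Nat.card (𝓞 K ⧸ I) = p := by
    rw [← hN, Ideal.absNorm_apply]
    rfl
  have : Nontrivial (𝓞 K ⧸ I) := by
    rw [Ideal.Quotient.nontrivial_iff]
    rintro rfl
    rw [Ideal.absNorm_top] at hN
    exact (Fact.out : p.Prime).one_lt.ne hN
  obtain ⟨n, hn⟩ := AddSubgroup.mem_zmultiples_iff.1 (mem_zmultiples_of_prime_card hcard
    (one_ne_zero : (1 : 𝓞 K ⧸ I) ≠ 0) (g' := Ideal.Quotient.mk I x))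
  refine ⟨n, Ideal.Quotient.eq.1 ?_⟩
  rw [← hn]
  simp

theorem valued_adicCompletion_lt_one_iff (v : HeightOneSpectrum (𝓞 K)) (x : 𝓞 K) :
    Valued.v (algebraMap K (v.adicCompletion K) x) < 1 ↔ x ∈ v.asIdeal := by
  rw [← v.valuation_lt_one_iff_mem (K := K),
    ← HeightOneSpectrum.valuedAdicCompletion_eq_valuation' v]
  rfl

theorem valued_adicCompletion_eq_one_iff (v : HeightOneSpectrum (𝓞 K)) (x : 𝓞 K) :
    Valued.v (algebraMap K (v.adicCompletion K) x) = 1 ↔ x ∉ v.asIdeal := by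
  rw [← v.valuation_eq_one_iff_notMem (K := K),
    ← HeightOneSpectrum.valuedAdicCompletion_eq_valuation' v]
  rfl

theorem norm_adicCompletion_lt_one_iff (v : HeightOneSpectrum (𝓞 K)) (x : v.adicCompletion K) :
    ‖x‖ < 1 ↔ Valued.v x < 1 := Valued.toNormedField.norm_lt_one_iff

theorem norm_adicCompletion_le_one_iff (v : HeightOneSpectrum (𝓞 K)) (x : v.adicCompletion K) :
    ‖x‖ ≤ 1 ↔ Valued.v x ≤ 1 := Valued.toNormedField.norm_le_one_iff

theorem exists_sq_eq_of_valued_sub_one_lt_one (v : HeightOneSpectrum (𝓞 K))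
    (h2 : (2 : 𝓞 K) ∉ v.asIdeal) {w : v.adicCompletion K} (hw : Valued.v (w - 1) < 1) :
    ∃ t, t ^ 2 = w := by
  have : IsUltrametricDist (v.adicCompletion K) := inferInstance
  refine exists_sq_eq_of_norm_sub_one_lt_one ?_ ((norm_adicCompletion_lt_one_iff v _).2 hw)
  have h := (valued_adicCompletion_eq_one_iff v 2).2 h2
  have e : algebraMap K (v.adicCompletion K) (2 : 𝓞 K) = 2 := map_ofNat _ 2
  rw [e] at h
  exact le_antisymm ((norm_adicCompletion_le_one_iff v _).2 h.le)
    (not_lt.1 fun h' => ((norm_adicCompletion_lt_one_iff v _).1 h').ne h)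

/-- When the residue field is the prime field, every local integer is congruent to a rational
integer. -/
theorem exists_int_valued_sub_lt_one (v : HeightOneSpectrum (𝓞 K)) (p : ℕ) [Fact p.Prime]
    (hN : Ideal.absNorm v.asIdeal = p) {t : v.adicCompletion K} (ht : Valued.v t ≤ 1) :
    ∃ n : ℤ, Valued.v (t - n) < 1 := by
  -- Three successive approximations with error in the maximal ideal: by an element of `K`, by a
  -- global integer, by a rational integer.
  obtain ⟨s, hs⟩ := (HeightOneSpectrum.denseRange_algebraMap (K := K) v).exists_dist_lt t
    zero_lt_one
  rw [dist_eq_norm, norm_adicCompletion_lt_one_iff] at hs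
  have hs1 : Valued.v (algebraMap K (v.adicCompletion K) s) ≤ 1 := by
    have := Valuation.map_sub (Valued.v) t (t - algebraMap K (v.adicCompletion K) s)
    rw [sub_sub_cancel] at this
    exact this.trans (max_le ht hs.le)
  obtain ⟨a, ha⟩ := v.exists_valuation_sub_lt_of_integer (K := K) (x := s)
    (by rw [← HeightOneSpectrum.valuedAdicCompletion_eq_valuation' v]; exact hs1) 1
  obtain ⟨n, hn⟩ := exists_int_sub_mem_of_absNorm_eq v.asIdeal p hN a
  rw [← valued_adicCompletion_lt_one_iff] at hn
  rw [← HeightOneSpectrum.valuedAdicCompletion_eq_valuation' v] at ha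
  have ha' : Valued.v (algebraMap K (v.adicCompletion K) (a - s)) < 1 := ha
  refine ⟨n, ?_⟩
  have e : t - n = (t - algebraMap K (v.adicCompletion K) s)
      - algebraMap K (v.adicCompletion K) (a - s)
      + algebraMap K (v.adicCompletion K) ((a - n : 𝓞 K) : K) := by
    simp
  rw [e]
  exact Valuation.map_add_lt _ (Valuation.map_sub_lt _ hs ha') hn

theorem not_dvd_one_add_sq {p : ℕ} [Fact p.Prime] (hp : p % 4 = 3) (n : ℤ) :
    ¬ (p : ℤ) ∣ 1 + n ^ 2 := by
  intro h
  rw [← ZMod.intCast_zmod_eq_zero_iff_dvd] at h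
  push_cast at h
  refine ZMod.exists_sq_eq_neg_one_iff.1 ⟨(n : ZMod p), ?_⟩ hp
  linear_combination -h

theorem int_mem_iff_dvd (I : Ideal (𝓞 K)) (hI : I ≠ ⊤) (p : ℕ) [hp : Fact p.Prime]
    (hpI : (p : 𝓞 K) ∈ I) (n : ℤ) : (n : 𝓞 K) ∈ I ↔ (p : ℤ) ∣ n := by
  constructor
  · intro h
    by_contra hn
    obtain ⟨x, y, hxy⟩ := ((Nat.prime_iff_prime_int.1 hp.out).coprime_iff_not_dvd).2 hn
    refine hI ((Ideal.eq_top_iff_one I).2 ?_)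
    have e : (1 : 𝓞 K) = x * p + y * n := by
      rw [← Int.cast_natCast (R := 𝓞 K) p]
      exact_mod_cast congrArg (Int.cast (R := 𝓞 K)) hxy.symm
    rw [e]
    exact I.add_mem (I.mul_mem_left _ hpI) (I.mul_mem_left _ h)
  · rintro ⟨k, rfl⟩
    push_cast
    exact I.mul_mem_right _ hpI

/-! ### The Hilbert symbol `(-1, S)` at places of degree one -/

section Hilbert

variable (v : HeightOneSpectrum (𝓞 K)) (p : ℕ) [Fact p.Prime] (hp : p % 4 = 3)
  (hpv : (p : 𝓞 K) ∈ v.asIdeal) (hN : Ideal.absNorm v.asIdeal = p)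

-- Replacing `t` by a congruent rational integer `n` reduces this to `p ∤ 1 + n²`, that is, to `-1`
-- being a nonresidue.
include hp hpv hN in
theorem valued_one_add_sq {t : v.adicCompletion K} (ht : Valued.v t ≤ 1) :
    Valued.v (1 + t ^ 2) = 1 := by
  obtain ⟨n, hn⟩ := exists_int_valued_sub_lt_one v p hN ht
  have h1 : Valued.v (algebraMap K (v.adicCompletion K) ((1 + n ^ 2 : ℤ) : 𝓞 K)) = 1 := by
    rw [valued_adicCompletion_eq_one_iff, int_mem_iff_dvd _ v.isPrime.ne_top p hpv]
    exact not_dvd_one_add_sq hp n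
  have h2 : Valued.v (n : v.adicCompletion K) ≤ 1 := by
    have := v.coe_mem_adicCompletionIntegers (K := K) (n : 𝓞 K)
    rw [HeightOneSpectrum.mem_adicCompletionIntegers] at this
    simpa using this
  have e : 1 + t ^ 2 = algebraMap K (v.adicCompletion K) ((1 + n ^ 2 : ℤ) : 𝓞 K)
      + (t - n) * (t + n) := by
    simp
    ring
  rw [e, Valuation.map_add_eq_of_lt_left, h1]
  rw [h1, map_mul]
  calc Valued.v (t - n) * Valued.v (t + n) ≤ Valued.v (t - n) * 1 :=
        mul_le_mul_right ((Valuation.map_add _ _ _).trans (max_le ht h2)) _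
    _ < 1 := by rwa [mul_one]

-- Factoring out the variable of larger absolute value leaves `1 + t²` with `t` integral, a unit;
-- `w` is that variable.
include hp hpv hN in
theorem valued_sq_add_sq (x z : v.adicCompletion K) :
    ∃ w ∈ ({x, z} : Set (v.adicCompletion K)), (w = 0 → x = 0 ∧ z = 0) ∧
      Valued.v (z ^ 2 + x ^ 2) = Valued.v w ^ 2 := by
  have key : ∀ x z : v.adicCompletion K, Valued.v x ≤ Valued.v z → (z = 0 → x = 0) ∧
      Valued.v (z ^ 2 + x ^ 2) = Valued.v z ^ 2 := by
    intro x z h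
    rcases eq_or_ne z 0 with rfl | hz
    · have : x = 0 := by simpa using h
      simp [this]
    · refine ⟨fun h => absurd h hz, ?_⟩
      have e : z ^ 2 + x ^ 2 = z ^ 2 * (1 + (x / z) ^ 2) := by field_simp
      rw [e, map_mul, valued_one_add_sq v p hp hpv hN, mul_one, map_pow]
      rw [map_div₀]
      exact div_le_one_of_le₀ h zero_le
  rcases le_total (Valued.v x) (Valued.v z) with h | h
  · exact ⟨z, by simp, fun hz => ⟨(key x z h).1 hz, hz⟩, (key x z h).2⟩
  · exact ⟨x, by simp, fun hz => ⟨hz, (key z x h).1 hz⟩, by rw [add_comm]; exact (key z x h).2⟩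

include hp hpv hN in
/-- At a place of degree one above `p ≡ 3 mod 4`, the Hilbert symbol `(-1, S)` is trivial
exactly when `S` has even valuation. -/
theorem hilbertSymbol_neg_one_eq_one_iff {S : K} (hS : S ≠ 0) :
    hilbertSymbol (v.adicCompletion K) (-1) (algebraMap K (v.adicCompletion K) S) = 1 ↔
      Even (ordAt v S) := by
  have hvS : Valued.v (algebraMap K (v.adicCompletion K) S) = v.valuation K S :=
    HeightOneSpectrum.valuedAdicCompletion_eq_valuation' v S
  have hvS0 : v.valuation K S ≠ 0 := (Valuation.ne_zero_iff _).2 hS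
  unfold hilbertSymbol
  simp only [ite_eq_left_iff, Int.reduceNeg, reduceCtorEq, imp_false, not_not]
  constructor
  · rintro ⟨x, y, z, h0, h⟩
    obtain ⟨w, -, hw0, hw⟩ := valued_sq_add_sq v p hp hpv hN x z
    have e : z ^ 2 + x ^ 2 = algebraMap K (v.adicCompletion K) S * y ^ 2 := by
      rw [h]; ring
    rw [e, map_mul, hvS, map_pow] at hw
    have hy : y ≠ 0 := by
      rintro rfl
      have : w = 0 := by simpa using hw.symm
      obtain ⟨rfl, rfl⟩ := hw0 this
      simp at h0
    have hvy : Valued.v y ≠ 0 := (Valuation.ne_zero_iff _).2 hy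
    have := congrArg WithZero.log hw
    rw [WithZero.log_mul hvS0 (pow_ne_zero _ hvy), WithZero.log_pow, WithZero.log_pow] at this
    rw [ordAt, even_neg]
    simp only [nsmul_eq_mul] at this
    exact ⟨WithZero.log (Valued.v w) - WithZero.log (Valued.v y), by push_cast at this; linarith⟩
  · rintro ⟨k, hk⟩
    -- Dividing by `π ^ (2k)` changes `S` only by a square and makes it a unit `u`.
    obtain ⟨π, hπ⟩ := v.valuation_exists_uniformizer K
    have hπ0 : π ≠ 0 := by
      rintro rfl
      rw [map_zero] at hπ
      exact WithZero.exp_ne_zero hπ.symm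
    have hlog : WithZero.log (v.valuation K S) = -(k + k) := by
      rw [← hk, ordAt, neg_neg]
    have hu : v.valuation K (S / (π ^ k) ^ 2) = 1 := by
      rw [map_div₀, map_pow, map_zpow₀, hπ, ← WithZero.exp_log hvS0, hlog, ← WithZero.exp_zsmul,
        ← WithZero.exp_nsmul, div_eq_one_iff_eq WithZero.exp_ne_zero]
      congr 1
      simp only [smul_eq_mul, nsmul_eq_mul]
      push_cast
      ring
    set u := algebraMap K (v.adicCompletion K) (S / (π ^ k) ^ 2) with hudef
    obtain ⟨n, hn⟩ := exists_int_valued_sub_lt_one v p hN (t := u)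
      (by rw [← hu]; exact (HeightOneSpectrum.valuedAdicCompletion_eq_valuation' v _).le)
    have hu' : Valued.v u = 1 :=
      (HeightOneSpectrum.valuedAdicCompletion_eq_valuation' v _).trans hu
    -- Every residue modulo `p` is a sum of two squares, so `u` is congruent to some `m = a² + b²`.
    -- Then `u / m` is close to `1`, hence a square `t²`.
    obtain ⟨a, b, hab⟩ := ZMod.sq_add_sq p (n : ZMod p)
    obtain ⟨a, rfl⟩ := ZMod.intCast_surjective a
    obtain ⟨b, rfl⟩ := ZMod.intCast_surjective b
    have hm : Valued.v ((n : v.adicCompletion K) - (a ^ 2 + b ^ 2 : ℤ)) < 1 := by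
      have h := (int_mem_iff_dvd _ v.isPrime.ne_top p hpv (n - (a ^ 2 + b ^ 2))).2 (by
        rw [← ZMod.intCast_zmod_eq_zero_iff_dvd]
        push_cast
        rw [hab, sub_self])
      rw [← valued_adicCompletion_lt_one_iff] at h
      simpa using h
    set m : v.adicCompletion K := ((a ^ 2 + b ^ 2 : ℤ) : v.adicCompletion K) with hmdef
    have hum : Valued.v (u - m) < 1 := by
      have := Valuation.map_add_lt _ hn hm
      rwa [sub_add_sub_cancel] at this
    have hm1 : Valued.v m = 1 := by
      have := Valuation.map_sub_eq_of_lt_right (v := Valued.v) (x := u - m) (y := u)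
        (by rwa [hu'])
      rw [← hu', ← this, ← Valuation.map_neg]
      congr 1
      ring
    have hm0 : m ≠ 0 := by
      rw [← Valuation.ne_zero_iff Valued.v, hm1]
      exact one_ne_zero
    have h2 : (2 : 𝓞 K) ∉ v.asIdeal := by
      have := int_mem_iff_dvd _ v.isPrime.ne_top p hpv 2
      rw [show ((2 : ℤ) : 𝓞 K) = 2 by norm_num] at this
      rw [this]
      intro h
      have := Int.le_of_dvd (by norm_num) h
      have := (Fact.out : p.Prime).two_le
      omega
    obtain ⟨t, ht⟩ := exists_sq_eq_of_valued_sub_one_lt_one v h2 (w := u / m) (by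
      rw [div_sub_one hm0, map_div₀, hm1, div_one]
      exact hum)
    set q := algebraMap K (v.adicCompletion K) (π ^ k) with hq
    have hSu : algebraMap K (v.adicCompletion K) S = q ^ 2 * u := by
      rw [hq, hudef, ← map_pow, ← map_mul]
      congr 1
      have := zpow_ne_zero k hπ0
      field_simp
    refine ⟨q * t * b, 1, q * t * a, by simp, ?_⟩
    have : t ^ 2 * (a ^ 2 + b ^ 2) = u := by
      rw [ht, show (a : v.adicCompletion K) ^ 2 + b ^ 2 = m by simp [hmdef]]
      field_simp
    rw [hSu]
    linear_combination q ^ 2 * this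

end Hilbert

/-! ### Norms of ideals containing `p` -/

theorem absNorm_span_natCast (p : ℕ) :
    Ideal.absNorm (Ideal.span {(p : 𝓞 K)}) = p ^ Module.finrank ℚ K := by
  rw [Ideal.absNorm_span_singleton, ← RingOfIntegers.rank K]
  have := Algebra.norm_algebraMap (S := 𝓞 K) (p : ℤ)
  rw [map_natCast] at this
  rw [this, Int.natAbs_pow, Int.natAbs_natCast]

theorem dvd_absNorm_of_mem {I : Ideal (𝓞 K)} (hI : I ≠ ⊤) {p : ℕ} (hp : p.Prime)
    (hpI : (p : 𝓞 K) ∈ I) : p ∣ Ideal.absNorm I := by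
  have h : Ideal.absNorm I ∣ p ^ Module.finrank ℚ K := by
    rw [← absNorm_span_natCast]
    exact Ideal.absNorm_dvd_absNorm_of_le ((Ideal.span_singleton_le_iff_mem I).2 hpI)
  obtain ⟨k, -, hk⟩ := (Nat.dvd_prime_pow hp).1 h
  rcases k with _ | k
  · exact absurd (Ideal.absNorm_eq_one_iff.1 hk) hI
  · rw [hk]
    exact dvd_pow_self p k.succ_ne_zero

/-- In an at most quadratic field the ideal `(p, α - A)` attached to a simple root `A` modulo `p`
of `X² - α²` is prime, provided that it and its conjugate are proper. -/
theorem isPrime_span_pair_of_finrank_le_two (hK : Module.finrank ℚ K ≤ 2) {p : ℕ} (hp : p.Prime)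
    {α : 𝓞 K} {A : ℤ} (hA : ¬ (p : ℤ) ∣ 2 * A)
    (h₁ : Ideal.span {(p : 𝓞 K), α - A} ≠ ⊤) (h₂ : Ideal.span {(p : 𝓞 K), α + A} ≠ ⊤) :
    (Ideal.span {(p : 𝓞 K), α - A}).IsPrime := by
  set I := Ideal.span {(p : 𝓞 K), α - A}
  set J := Ideal.span {(p : 𝓞 K), α + A}
  have hI : (p : 𝓞 K) ∈ I := Ideal.subset_span (by simp)
  have hJ : (p : 𝓞 K) ∈ J := Ideal.subset_span (by simp)
  have hI' : α - A ∈ I := Ideal.subset_span (by simp)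
  have hJ' : α + A ∈ J := Ideal.subset_span (by simp)
  -- Both `p²` and `2Ap = p(α + A) - (α - A)p` lie in `I * J`, and `2A` is invertible modulo `p`.
  have hIJ : (p : 𝓞 K) ∈ I * J := by
    obtain ⟨x, y, hxy⟩ := ((Nat.prime_iff_prime_int.1 hp).coprime_iff_not_dvd).2 hA
    have hxy' : (x : 𝓞 K) * p + y * (2 * A) = 1 := by
      rw [← Int.cast_natCast (R := 𝓞 K) p]
      exact_mod_cast congrArg (Int.cast (R := 𝓞 K)) hxy
    have e : (p : 𝓞 K) = x * (p * p) + y * (p * (α + A) - (α - A) * p) := by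
      linear_combination -(p : 𝓞 K) * hxy'
    rw [e]
    exact add_mem (Ideal.mul_mem_left _ _ (Ideal.mul_mem_mul hI hJ)) (Ideal.mul_mem_left _ _
      (sub_mem (Ideal.mul_mem_mul hI hJ') (Ideal.mul_mem_mul hI' hJ)))
  -- The two norms are multiples of `p` whose product divides `p²`, so each is `p`.
  have hdvd : Ideal.absNorm I * Ideal.absNorm J ∣ p ^ 2 := by
    rw [← map_mul]
    refine (Ideal.absNorm_dvd_absNorm_of_le
      ((Ideal.span_singleton_le_iff_mem _).2 hIJ)).trans ?_
    rw [absNorm_span_natCast]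
    exact pow_dvd_pow p hK
  have hIp : Ideal.absNorm I ∣ p := by
    refine Nat.dvd_of_mul_dvd_mul_right hp.pos ?_
    rw [← sq]
    exact (mul_dvd_mul_left _ (dvd_absNorm_of_mem h₂ hp hJ)).trans hdvd
  refine Ideal.isPrime_of_irreducible_absNorm ?_
  rw [Nat.dvd_antisymm hIp (dvd_absNorm_of_mem h₁ hp hI)]
  exact hp

/-! ### As many places above `p` as the degree force complete splitting -/

section SplitCompletely

variable {p : ℕ} (hp : p.Prime) {s : Finset (HeightOneSpectrum (𝓞 K))}
  (hs : ∀ P ∈ s, (p : 𝓞 K) ∈ P.asIdeal) (hcard : Module.finrank ℚ K ≤ s.card)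

include hs in
theorem prod_asIdeal_dvd_span : ∏ P ∈ s, P.asIdeal ∣ Ideal.span {(p : 𝓞 K)} := by
  classical
  rw [← Finset.prod_image (f := fun I : Ideal (𝓞 K) => I)
    fun P _ Q _ h => HeightOneSpectrum.ext h]
  refine Finset.prod_primes_dvd _ (fun I hI => ?_) fun I hI => ?_
  · obtain ⟨P, -, rfl⟩ := Finset.mem_image.1 hI
    exact P.prime
  · obtain ⟨P, hP, rfl⟩ := Finset.mem_image.1 hI
    exact Ideal.dvd_span_singleton.2 (hs P hP)

-- The product divides `(p)` and has norm divisible by `p ^ s.card`, while `(p)` has norm at most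
-- that; the cofactor has norm `1`.
include hp hs hcard in
theorem prod_asIdeal_eq_span : ∏ P ∈ s, P.asIdeal = Ideal.span {(p : 𝓞 K)} := by
  obtain ⟨J, hJ⟩ := prod_asIdeal_dvd_span hs
  have h1 : p ^ s.card ∣ ∏ P ∈ s, Ideal.absNorm P.asIdeal := by
    rw [← Finset.prod_const]
    exact Finset.prod_dvd_prod_of_dvd _ _ fun P hP => dvd_absNorm_of_mem P.isPrime.ne_top hp (hs P hP)
  have h2 := congrArg Ideal.absNorm hJ
  rw [absNorm_span_natCast, map_mul, map_prod] at h2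
  have h3 : p ^ s.card * Ideal.absNorm J ∣ p ^ s.card * 1 := by
    rw [mul_one]
    exact ((mul_dvd_mul_right h1 _).trans h2.symm.dvd).trans (pow_dvd_pow p hcard)
  have h4 := Nat.dvd_of_mul_dvd_mul_left (pow_pos hp.pos _) h3
  rw [hJ, Ideal.absNorm_eq_one_iff.1 (Nat.dvd_one.1 h4), Ideal.mul_top]

-- The other factors already use up `p ^ (s.card - 1)` of the norm of `(p)`, leaving at most one
-- factor `p` for `P`.
include hp hs hcard in
theorem absNorm_eq_of_finrank_le_card {P : HeightOneSpectrum (𝓞 K)} (hP : P ∈ s) :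
    Ideal.absNorm P.asIdeal = p := by
  classical
  refine Nat.dvd_antisymm ?_ (dvd_absNorm_of_mem P.isPrime.ne_top hp (hs P hP))
  have h1 : p ^ (s.card - 1) ∣ ∏ Q ∈ s.erase P, Ideal.absNorm Q.asIdeal := by
    rw [← Finset.card_erase_of_mem hP, ← Finset.prod_const]
    exact Finset.prod_dvd_prod_of_dvd _ _ fun Q hQ =>
      dvd_absNorm_of_mem Q.isPrime.ne_top hp (hs Q (Finset.mem_of_mem_erase hQ))
  have h2 := congrArg Ideal.absNorm (prod_asIdeal_eq_span hp hs hcard)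
  rw [absNorm_span_natCast, map_prod, ← Finset.mul_prod_erase _ _ hP] at h2
  refine Nat.dvd_of_mul_dvd_mul_right (pow_pos hp.pos (s.card - 1)) ?_
  refine (mul_dvd_mul_left _ h1).trans (h2.dvd.trans ?_)
  rw [← pow_succ', Nat.sub_add_cancel (Finset.card_pos.2 ⟨P, hP⟩)]
  exact pow_dvd_pow p hcard

include hp hs hcard in
theorem mem_of_finrank_le_card {P : HeightOneSpectrum (𝓞 K)} (hP : (p : 𝓞 K) ∈ P.asIdeal) :
    P ∈ s := by
  have h : ∏ Q ∈ s, Q.asIdeal ≤ P.asIdeal := by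
    rw [prod_asIdeal_eq_span hp hs hcard]
    exact (Ideal.span_singleton_le_iff_mem _).2 hP
  obtain ⟨Q, hQ, hQP⟩ := (Ideal.IsPrime.prod_le P.isPrime).1 h
  have : Q = P := HeightOneSpectrum.ext (Q.isMaximal.eq_of_le P.isPrime.ne_top hQP)
  exact this ▸ hQ

-- `(p)` is a product of distinct primes, so `P` divides it exactly once.
include hp hs hcard in
theorem valuation_eq_exp_neg_one {P : HeightOneSpectrum (𝓞 K)} (hP : P ∈ s) :
    P.valuation K p = WithZero.exp (-1) := by
  classical
  have hnot : (p : 𝓞 K) ∉ P.asIdeal ^ 2 := by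
    intro h
    have h1 : P.asIdeal ^ 2 ∣ ∏ Q ∈ s, Q.asIdeal := by
      rw [prod_asIdeal_eq_span hp hs hcard, Ideal.dvd_span_singleton]
      exact h
    rw [sq, ← Finset.mul_prod_erase _ _ hP] at h1
    have h2 := (mul_dvd_mul_iff_left P.ne_bot).1 h1
    obtain ⟨Q, hQ, hPQ⟩ := (P.prime.dvd_finsetProd_iff _).1 h2
    refine Finset.ne_of_mem_erase hQ (HeightOneSpectrum.ext ?_)
    exact Q.isMaximal.eq_of_le P.isPrime.ne_top (Ideal.dvd_iff_le.1 hPQ)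
  have hp0 : (p : 𝓞 K) ≠ 0 := Nat.cast_ne_zero.2 hp.ne_zero
  have e : P.valuation K p = P.intValuation (p : 𝓞 K) := by
    rw [← HeightOneSpectrum.valuation_of_algebraMap (K := K)]
    simp
  have h1 := (P.intValuation_le_pow_iff_mem (p : 𝓞 K) 1).2 (by simpa using hs P hP)
  have h2 := mt (P.intValuation_le_pow_iff_mem (p : 𝓞 K) 2).1 hnot
  rw [e, ← WithZero.exp_log (P.intValuation_ne_zero _ hp0)]
  rw [← WithZero.exp_log (P.intValuation_ne_zero _ hp0), WithZero.exp_le_exp] at h1 h2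
  congr 1
  push_cast at h1 h2
  omega

end SplitCompletely

/-! ### Valuations in subfields and degree bounds -/

theorem ordAt_eq_of_liesOver {k : Type*} [Field k] [NumberField k] [Algebra k K]
    (v : HeightOneSpectrum (𝓞 k)) (w : HeightOneSpectrum (𝓞 K)) [w.asIdeal.LiesOver v.asIdeal]
    {x : k} (hx : w.valuation K (algebraMap k K x) = WithZero.exp (-1)) (y : k) :
    ordAt v y = ordAt w (algebraMap k K y) := by
  have h (z : k) : v.valuation k z ^ v.asIdeal.ramificationIdx' w.asIdeal =
      w.valuation K (algebraMap k K z) := HeightOneSpectrum.valuation_liesOver K v w z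
  -- On logarithms, the ramification index times an integer equals `-1`.
  have he : v.asIdeal.ramificationIdx' w.asIdeal = 1 := by
    have h1 := congrArg WithZero.log (h x)
    rw [hx, WithZero.log_pow, WithZero.log_exp, nsmul_eq_mul] at h1
    refine Nat.isUnit_iff.1 (Int.ofNat_isUnit.1 (IsUnit.of_mul_eq_one
      (-(v.valuation k x).log) ?_))
    rw [mul_neg, h1, neg_neg]
  rw [ordAt, ordAt, ← h y, he, pow_one]

theorem ordAt_mul (v : HeightOneSpectrum (𝓞 K)) {x y : K} (hx : x ≠ 0) (hy : y ≠ 0) :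
    ordAt v (x * y) = ordAt v x + ordAt v y := by
  rw [ordAt, ordAt, ordAt, map_mul, WithZero.log_mul ((Valuation.ne_zero_iff _).2 hx)
    ((Valuation.ne_zero_iff _).2 hy)]
  ring

theorem finrank_adjoin_simple_le_two {L : Type*} [Field L] [NumberField L] {r : L} {a : ℤ}
    (hr : r ^ 2 = a) : Module.finrank ℚ ℚ⟮r⟯ ≤ 2 := by
  rw [IntermediateField.adjoin.finrank (Algebra.IsIntegral.isIntegral r)]
  have hne : (Polynomial.X ^ 2 - Polynomial.C (a : ℚ)) ≠ 0 :=
    Polynomial.X_pow_sub_C_ne_zero two_pos _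
  have := Polynomial.natDegree_le_of_dvd (minpoly.dvd ℚ r
    (p := Polynomial.X ^ 2 - Polynomial.C (a : ℚ)) (by simp [hr])) hne
  rwa [Polynomial.natDegree_X_pow_sub_C] at this

theorem finrank_le_four {r t : K} {a b : ℤ} (hr : r ^ 2 = a) (ht : t ^ 2 = b)
    (hK : IntermediateField.adjoin ℚ {r, t} = (⊤ : IntermediateField ℚ K)) :
    Module.finrank ℚ K ≤ 4 := by
  have h := IntermediateField.finrank_sup_le ℚ⟮r⟯ ℚ⟮t⟯
  rw [← IntermediateField.adjoin_union, Set.singleton_union, hK,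
    IntermediateField.finrank_top'] at h
  exact h.trans (Nat.mul_le_mul (finrank_adjoin_simple_le_two hr)
    (finrank_adjoin_simple_le_two ht))

omit [NumberField K] in
theorem isIntegral_of_sq_eq_int {r : K} {a : ℤ} (hr : r ^ 2 = a) : IsIntegral ℤ r :=
  IsIntegral.of_pow two_pos (hr ▸ isIntegral_algebraMap (R := ℤ) (x := a))

/-! ### Places with prescribed residues of the square roots -/

theorem exists_heightOneSpectrum_natCast_mem {p : ℕ} (hp : p.Prime) :
    ∃ P : HeightOneSpectrum (𝓞 K), (p : 𝓞 K) ∈ P.asIdeal := by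
  have hne : Ideal.span {(p : 𝓞 K)} ≠ ⊤ := by
    intro h
    have := absNorm_span_natCast (K := K) p
    rw [h, Ideal.absNorm_top] at this
    exact (Nat.one_lt_pow Module.finrank_pos.ne' hp.one_lt).ne this
  obtain ⟨M, hM, hle⟩ := Ideal.exists_le_maximal _ hne
  have hpM : (p : 𝓞 K) ∈ M := (Ideal.span_singleton_le_iff_mem _).1 hle
  refine ⟨⟨M, hM.isPrime, ?_⟩, hpM⟩
  rintro rfl
  exact hp.ne_zero (Nat.cast_eq_zero.1 (Ideal.mem_bot.1 hpM))

omit [NumberField K] in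
theorem exists_heightOneSpectrum_comap (P : HeightOneSpectrum (𝓞 K)) (e : 𝓞 K ≃+* 𝓞 K) :
    ∃ Q : HeightOneSpectrum (𝓞 K), ∀ x, x ∈ Q.asIdeal ↔ e x ∈ P.asIdeal := by
  refine ⟨⟨P.asIdeal.comap e, P.isPrime.comap e, ?_⟩, fun x => Iff.rfl⟩
  intro h
  refine P.ne_bot (eq_bot_iff.2 fun x hx => ?_)
  have : e.symm x ∈ P.asIdeal.comap e := by
    rw [Ideal.mem_comap, RingEquiv.apply_symm_apply]
    exact hx
  rw [h] at this
  simpa using this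

/-- The place `(p, r - A)` of `ℚ(r)`, together with the comparison of valuations with the
places of the ambient field above it. -/
theorem exists_heightOneSpectrum_adjoin {r : K} {a : ℤ} (hr : r ^ 2 = a) {p : ℕ} (hp : p.Prime)
    {A : ℤ} (hA : ¬ (p : ℤ) ∣ 2 * A) (ρ : 𝓞 K) (hρ : (ρ : K) = r)
    (α : 𝓞 ℚ⟮r⟯) (hα : ((α : ℚ⟮r⟯) : K) = r)
    {P Q : HeightOneSpectrum (𝓞 K)} (hP : (p : 𝓞 K) ∈ P.asIdeal) (hPr : ρ - A ∈ P.asIdeal)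
    (hQ : (p : 𝓞 K) ∈ Q.asIdeal) (hQr : ρ + A ∈ Q.asIdeal) :
    ∃ v : HeightOneSpectrum (𝓞 ℚ⟮r⟯),
      v.asIdeal = Ideal.span {(p : 𝓞 ℚ⟮r⟯), α - (A : 𝓞 ℚ⟮r⟯)} ∧
      ∀ w : HeightOneSpectrum (𝓞 K), (p : 𝓞 K) ∈ w.asIdeal → ρ - A ∈ w.asIdeal →
        w.valuation K p = WithZero.exp (-1) → ∀ T : ℚ⟮r⟯, ordAt v T = ordAt w (T : K) := by
  have hαρ : algebraMap (𝓞 ℚ⟮r⟯) (𝓞 K) α = ρ := RingOfIntegers.ext (hα.trans hρ.symm)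
  have hle₁ (w : HeightOneSpectrum (𝓞 K)) (hw : (p : 𝓞 K) ∈ w.asIdeal)
      (hw' : ρ - A ∈ w.asIdeal) : Ideal.span {(p : 𝓞 ℚ⟮r⟯), α - (A : 𝓞 ℚ⟮r⟯)} ≤
        w.asIdeal.under (𝓞 ℚ⟮r⟯) := by
    rw [Ideal.span_le]
    rintro x (rfl | rfl)
    · simpa [Ideal.under] using hw
    · simpa [Ideal.under, hαρ] using hw'
  have hle₂ : Ideal.span {(p : 𝓞 ℚ⟮r⟯), α + (A : 𝓞 ℚ⟮r⟯)} ≤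
        Q.asIdeal.under (𝓞 ℚ⟮r⟯) := by
    rw [Ideal.span_le]
    rintro x (rfl | rfl)
    · simpa [Ideal.under] using hQ
    · simpa [Ideal.under, hαρ] using hQr
  have htop (w : HeightOneSpectrum (𝓞 K)) : w.asIdeal.under (𝓞 ℚ⟮r⟯) ≠ ⊤ :=
    (w.isPrime.comap _).ne_top
  -- The ideal and its conjugate are proper because they lie in the contractions of `P` and `Q`.
  have hprime := isPrime_span_pair_of_finrank_le_two (finrank_adjoin_simple_le_two hr) hp
    (α := α) hA (ne_top_of_le_ne_top (htop P) (hle₁ P hP hPr)) (ne_top_of_le_ne_top (htop Q) hle₂)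
  have hbot : Ideal.span {(p : 𝓞 ℚ⟮r⟯), α - (A : 𝓞 ℚ⟮r⟯)} ≠ ⊥ := by
    intro h
    have h1 : (p : 𝓞 ℚ⟮r⟯) ∈ Ideal.span {(p : 𝓞 ℚ⟮r⟯), α - (A : 𝓞 ℚ⟮r⟯)} :=
      Ideal.subset_span (by simp)
    rw [h] at h1
    exact hp.ne_zero (Nat.cast_eq_zero.1 (Ideal.mem_bot.1 h1))
  refine ⟨⟨_, hprime, hbot⟩, rfl, fun w hw hwr hwp T => ?_⟩
  set v : HeightOneSpectrum (𝓞 ℚ⟮r⟯) := ⟨_, hprime, hbot⟩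
  have : w.asIdeal.LiesOver v.asIdeal :=
    ⟨v.isMaximal.eq_of_le (htop w) (hle₁ w hw hwr)⟩
  exact ordAt_eq_of_liesOver v w (x := (p : ℚ⟮r⟯)) (by rw [map_natCast]; exact hwp) T

-- `σ t` is a square root of `b`, so it is `±t`; the plus sign would fix both generators.
omit [NumberField K] in
theorem AlgEquiv.apply_eq_neg_of_adjoin_pair [CharZero K] {r t : K} {b : ℤ} (ht : t ^ 2 = b)
    (hK : IntermediateField.adjoin ℚ {r, t} = (⊤ : IntermediateField ℚ K)) {σ : K ≃ₐ[ℚ] K}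
    (hσ : σ ≠ AlgEquiv.refl) (hσr : σ r = r) : σ t = -t := by
  have h : σ t ^ 2 = t ^ 2 := by rw [← map_pow, ht, map_intCast]
  refine (sq_eq_sq_iff_eq_or_eq_neg.1 h).resolve_left fun hσt => hσ ?_
  have := IntermediateField.algHom_ext_of_eq_adjoin ℚ hK.symm
    (φ₁ := σ.toAlgHom.comp (IntermediateField.val ⊤)) (φ₂ := IntermediateField.val ⊤) (by
      rintro x (rfl | rfl)
      · exact hσr
      · exact hσt)
  ext x
  exact DFunLike.congr_fun this ⟨x, IntermediateField.mem_top⟩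

omit [NumberField K] in
theorem mem_adjoin_simple_of_eq [CharZero K] {r x : K} (u v : ℚ) (h : x = u + v * r) :
    x ∈ ℚ⟮r⟯ := by
  rw [h, ← eq_ratCast (algebraMap ℚ K) u, ← eq_ratCast (algebraMap ℚ K) v]
  exact add_mem (algebraMap_mem _ u)
    (mul_mem (algebraMap_mem _ v) (IntermediateField.mem_adjoin_simple_self ℚ r))

omit [NumberField K] in
theorem exists_ringOfIntegers_coe_eq {r : K} {a : ℤ} (hr : r ^ 2 = a) :
    ∃ ρ : 𝓞 K, (ρ : K) = r := ⟨⟨r, isIntegral_of_sq_eq_int hr⟩, rfl⟩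

theorem sub_mem_or_add_mem {P : HeightOneSpectrum (𝓞 K)} {p : ℕ} (hP : (p : 𝓞 K) ∈ P.asIdeal)
    {ρ : 𝓞 K} {a A : ℤ} (hρ : ρ ^ 2 = a) (hA : A ^ 2 ≡ a [ZMOD p]) :
    ρ - A ∈ P.asIdeal ∨ ρ + A ∈ P.asIdeal := by
  obtain ⟨k, hk⟩ := hA.dvd
  refine P.isPrime.mem_or_mem ?_
  have hk' : (a : 𝓞 K) - A ^ 2 = p * k := by
    exact_mod_cast congrArg (Int.cast (R := 𝓞 K)) hk
  have e : (ρ - A) * (ρ + A) = p * k := by linear_combination hρ + hk'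
  rw [e]
  exact Ideal.mul_mem_right _ _ hP

/-- If commuting sign changes of two square roots are realised by automorphisms, every choice of
their residues modulo `p` is realised by a place above `p`. -/
theorem exists_heightOneSpectrum_of_sq_roots {ρ τ : 𝓞 K} {a b : ℤ} (hρ : ρ ^ 2 = a)
    (hτ : τ ^ 2 = b) (e₁ e₂ : 𝓞 K ≃+* 𝓞 K) (h₁ρ : e₁ ρ = ρ) (h₁τ : e₁ τ = -τ)
    (h₂ρ : e₂ ρ = -ρ) {p : ℕ} [hp : Fact p.Prime] {A B : ℤ}
    (hA : A ^ 2 ≡ a [ZMOD p]) (hB : B ^ 2 ≡ b [ZMOD p]) :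
    ∃ P : HeightOneSpectrum (𝓞 K),
      (p : 𝓞 K) ∈ P.asIdeal ∧ ρ - A ∈ P.asIdeal ∧ τ - B ∈ P.asIdeal := by
  obtain ⟨P, hP, hPρ⟩ : ∃ P : HeightOneSpectrum (𝓞 K), (p : 𝓞 K) ∈ P.asIdeal ∧
      ρ - A ∈ P.asIdeal := by
    obtain ⟨P, hP⟩ := exists_heightOneSpectrum_natCast_mem (K := K) hp.out
    rcases sub_mem_or_add_mem hP hρ hA with h | h
    · exact ⟨P, hP, h⟩
    · obtain ⟨Q, hQ⟩ := exists_heightOneSpectrum_comap P e₂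
      refine ⟨Q, (hQ _).2 (by rwa [map_natCast]), (hQ _).2 ?_⟩
      rw [map_sub, h₂ρ, map_intCast, ← neg_add']
      exact neg_mem h
  rcases sub_mem_or_add_mem hP hτ hB with h | h
  · exact ⟨P, hP, hPρ, h⟩
  · obtain ⟨Q, hQ⟩ := exists_heightOneSpectrum_comap P e₁
    refine ⟨Q, (hQ _).2 (by rwa [map_natCast]), (hQ _).2 ?_, (hQ _).2 ?_⟩
    · rwa [map_sub, h₁ρ, map_intCast]
    · rw [map_sub, h₁τ, map_intCast, ← neg_add']
      exact neg_mem h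

/-- The residues of `ρ` and `τ` fix that of `γ`, since `g` is invertible modulo `P`. -/
theorem sub_mem_of_mul_eq_mul {P : HeightOneSpectrum (𝓞 K)} {p : ℕ} [Fact p.Prime]
    (hP : (p : 𝓞 K) ∈ P.asIdeal) {ρ τ γ : 𝓞 K} {A B C g : ℤ} (h : γ * g = ρ * τ)
    (hg : ¬ (p : ℤ) ∣ g) (hABC : C * g ≡ A * B [ZMOD p]) (hρ : ρ - A ∈ P.asIdeal)
    (hτ : τ - B ∈ P.asIdeal) : γ - C ∈ P.asIdeal := by
  have hmem : (γ - C) * g ∈ P.asIdeal := by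
    have h1 := (int_mem_iff_dvd _ P.isPrime.ne_top p hP _).2 hABC.dvd
    push_cast at h1
    have e : (γ - C) * g = (ρ - A) * τ + A * (τ - B) + (A * B - C * g) := by
      linear_combination h
    rw [e]
    exact add_mem (add_mem (Ideal.mul_mem_right _ _ hρ) (Ideal.mul_mem_left _ _ hτ)) h1
  refine (P.isPrime.mem_or_mem hmem).resolve_right fun h1 => hg ?_
  exact (int_mem_iff_dvd _ P.isPrime.ne_top p hP g).1 h1

theorem ne_of_sub_mem_of_add_mem {P Q : HeightOneSpectrum (𝓞 K)} {p : ℕ} [Fact p.Prime]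
    (hP : (p : 𝓞 K) ∈ P.asIdeal) {ρ : 𝓞 K} {A : ℤ} (hA : ¬ (p : ℤ) ∣ 2 * A)
    (h₁ : ρ - A ∈ P.asIdeal) (h₂ : ρ + A ∈ Q.asIdeal) : P ≠ Q := by
  rintro rfl
  refine hA ((int_mem_iff_dvd _ P.isPrime.ne_top p hP _).1 ?_)
  have := sub_mem h₂ h₁
  push_cast
  convert this using 1
  ring

theorem not_dvd_two_mul_of_sq_modEq {p : ℕ} [hp : Fact p.Prime] (hp2 : p ≠ 2) {a A : ℤ}
    (ha : ¬ (p : ℤ) ∣ a) (hA : A ^ 2 ≡ a [ZMOD p]) : ¬ (p : ℤ) ∣ 2 * A := by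
  intro h
  rcases (Nat.prime_iff_prime_int.1 hp.out).dvd_or_dvd h with h | h
  · exact hp2 ((Nat.prime_dvd_prime_iff_eq hp.out Nat.prime_two).1 (by exact_mod_cast h))
  · exact ha ((Int.ModEq.dvd_iff hA).1 (dvd_pow h two_ne_zero))

theorem not_dvd_of_legendreSym_eq_one {p : ℕ} [Fact p.Prime] {a : ℤ}
    (h : legendreSym p a = 1) : ¬ (p : ℤ) ∣ a := by
  rw [← ZMod.intCast_zmod_eq_zero_iff_dvd, ← legendreSym.eq_zero_iff, h]
  exact one_ne_zero

/-- The valuations of the three partial norms at a place determine twice the valuation of `S`. -/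
theorem even_ordAt_iff_four_dvd (P : HeightOneSpectrum (𝓞 K)) {x y z : K} (hx : x ≠ 0)
    (hy : y ≠ 0) (hz : z ≠ 0) : Even (ordAt P x) ↔
      4 ∣ ordAt P (x * y) + ordAt P (x * z) - ordAt P (y * z) := by
  rw [ordAt_mul P hx hy, ordAt_mul P hx hz, ordAt_mul P hy hz, Int.even_iff]
  omega

end Places

/-! ### The biquadratic field -/

theorem lemma2p1 {F : Type*} [Field F] [NumberField F]
    -- the biquadratic field `F = ℚ(√a, √b)`, with `√c = √a √b / gcd(a, b)`
    (a b c : ℤ) (ha : Squarefree a) (hb : Squarefree b) (ha1 : a ≠ 1) (hb1 : b ≠ 1)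
    (hab : ¬ IsSquare (a * b)) (hc : c * (Int.gcd a b : ℤ) ^ 2 = a * b)
    (ra rb rc : F) (hra : ra ^ 2 = (a : F)) (hrb : rb ^ 2 = (b : F))
    (hrc : rc * (Int.gcd a b : F) = ra * rb)
    (hF : IntermediateField.adjoin ℚ {ra, rb} = (⊤ : IntermediateField ℚ F))
    -- the nontrivial automorphisms that fix `F₁ = ℚ(√a)` and `F₂ = ℚ(√b)`
    (σ₁ σ₂ : F ≃ₐ[ℚ] F) (hσ₁ : σ₁ ≠ AlgEquiv.refl) (hσ₂ : σ₂ ≠ AlgEquiv.refl)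
    (hσ₁F : ∀ x ∈ ℚ⟮ra⟯, σ₁ x = x) (hσ₂F : ∀ x ∈ ℚ⟮rb⟯, σ₂ x = x)
    -- the number `S`
    (s₀ s₁ s₂ s₃ : ℤ) (S : F)
    (hS : S = (s₀ : F) + (s₁ : F) * ra + (s₂ : F) * rb + (s₃ : F) * rc) (hS0 : S ≠ 0)
    -- the prime number `p`
    (p : ℕ) [Fact p.Prime] (hp : p % 4 = 3)
    (hpS : ∃ n : ℤ, Algebra.norm ℚ S = (n : ℚ) ∧ (p : ℤ) ∣ n)
    (hpa : legendreSym p a = 1) (hpb : legendreSym p b = 1) (hpc : legendreSym p c = 1)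
    -- compatible square roots of `a`, `b`, `c` modulo `p`
    (A B C : ℤ) (hA : A ^ 2 ≡ a [ZMOD p]) (hB : B ^ 2 ≡ b [ZMOD p]) (hC : C ^ 2 ≡ c [ZMOD p])
    (hABC : C * (Int.gcd a b : ℤ) ≡ A * B [ZMOD p]) :
    -- there are exactly four `p`-adic places
    {P : HeightOneSpectrum (𝓞 F) | (p : 𝓞 F) ∈ P.asIdeal}.ncard = 4 ∧
    -- `√a`, `√b`, `√c` are integers of the quadratic subfields, the ideals `𝔭ᵢⱼ` are prime,
    -- the three products lie in the quadratic subfields, and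
    ∃ (α : 𝓞 ℚ⟮ra⟯) (β : 𝓞 ℚ⟮rb⟯) (γ : 𝓞 ℚ⟮rc⟯)
      (𝔭₁₁ 𝔭₁₂ : HeightOneSpectrum (𝓞 ℚ⟮ra⟯)) (𝔭₂₁ 𝔭₂₂ : HeightOneSpectrum (𝓞 ℚ⟮rb⟯))
      (𝔭₃₁ 𝔭₃₂ : HeightOneSpectrum (𝓞 ℚ⟮rc⟯)) (T₁ : ℚ⟮ra⟯) (T₂ : ℚ⟮rb⟯) (T₃ : ℚ⟮rc⟯),
      ((α : ℚ⟮ra⟯) : F) = ra ∧ ((β : ℚ⟮rb⟯) : F) = rb ∧ ((γ : ℚ⟮rc⟯) : F) = rc ∧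
      𝔭₁₁.asIdeal = Ideal.span {(p : 𝓞 ℚ⟮ra⟯), α - (A : 𝓞 ℚ⟮ra⟯)} ∧
      𝔭₁₂.asIdeal = Ideal.span {(p : 𝓞 ℚ⟮ra⟯), α + (A : 𝓞 ℚ⟮ra⟯)} ∧
      𝔭₂₁.asIdeal = Ideal.span {(p : 𝓞 ℚ⟮rb⟯), β - (B : 𝓞 ℚ⟮rb⟯)} ∧
      𝔭₂₂.asIdeal = Ideal.span {(p : 𝓞 ℚ⟮rb⟯), β + (B : 𝓞 ℚ⟮rb⟯)} ∧
      𝔭₃₁.asIdeal = Ideal.span {(p : 𝓞 ℚ⟮rc⟯), γ - (C : 𝓞 ℚ⟮rc⟯)} ∧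
      𝔭₃₂.asIdeal = Ideal.span {(p : 𝓞 ℚ⟮rc⟯), γ + (C : 𝓞 ℚ⟮rc⟯)} ∧
      (T₁ : F) = S * σ₁ S ∧ (T₂ : F) = S * σ₂ S ∧ (T₃ : F) = σ₁ S * σ₂ S ∧
      ((∀ P : HeightOneSpectrum (𝓞 F), (p : 𝓞 F) ∈ P.asIdeal →
          hilbertSymbol (P.adicCompletion F) (-1) (algebraMap F (P.adicCompletion F) S) = 1) ↔
        (4 ∣ ordAt 𝔭₁₁ T₁ + ordAt 𝔭₂₁ T₂ - ordAt 𝔭₃₁ T₃ ∧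
         4 ∣ ordAt 𝔭₁₁ T₁ + ordAt 𝔭₂₂ T₂ - ordAt 𝔭₃₂ T₃ ∧
         4 ∣ ordAt 𝔭₁₂ T₁ + ordAt 𝔭₂₁ T₂ - ordAt 𝔭₃₂ T₃ ∧
         4 ∣ ordAt 𝔭₁₂ T₁ + ordAt 𝔭₂₂ T₂ - ordAt 𝔭₃₁ T₃)) := by
  have hpp : p.Prime := Fact.out
  have hp2 : p ≠ 2 := by
    rintro rfl
    norm_num at hp
  have hpa' := not_dvd_of_legendreSym_eq_one hpa
  have hA2 := not_dvd_two_mul_of_sq_modEq hp2 hpa' hA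
  have hB2 := not_dvd_two_mul_of_sq_modEq hp2 (not_dvd_of_legendreSym_eq_one hpb) hB
  have hC2 := not_dvd_two_mul_of_sq_modEq hp2 (not_dvd_of_legendreSym_eq_one hpc) hC
  have hpg : ¬ (p : ℤ) ∣ (Int.gcd a b : ℤ) := fun h => hpa' (h.trans (Int.gcd_dvd_left ..))
  have hg0 : (Int.gcd a b : F) ≠ 0 := by
    rw [Nat.cast_ne_zero]
    intro h
    simp [h] at hpg
  have hrc2 : rc ^ 2 = (c : F) := by
    have hcF : (c : F) * (Int.gcd a b : F) ^ 2 = a * b := by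
      exact_mod_cast congrArg (Int.cast (R := F)) hc
    refine mul_right_cancel₀ (pow_ne_zero 2 hg0) ?_
    rw [← mul_pow, hrc, mul_pow, hra, hrb, hcF]
  -- action of the automorphisms
  have h1a : σ₁ ra = ra := hσ₁F _ (IntermediateField.mem_adjoin_simple_self ℚ ra)
  have h2b : σ₂ rb = rb := hσ₂F _ (IntermediateField.mem_adjoin_simple_self ℚ rb)
  have h1b : σ₁ rb = -rb := AlgEquiv.apply_eq_neg_of_adjoin_pair hrb hF hσ₁ h1a
  have h2a : σ₂ ra = -ra :=
    AlgEquiv.apply_eq_neg_of_adjoin_pair hra (by rwa [Set.pair_comm]) hσ₂ h2b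
  have h1c : σ₁ rc = -rc := by
    have := congrArg σ₁ hrc
    rw [map_mul, map_mul, map_natCast, h1a, h1b] at this
    refine mul_right_cancel₀ hg0 ?_
    linear_combination this + hrc
  have h2c : σ₂ rc = -rc := by
    have := congrArg σ₂ hrc
    rw [map_mul, map_mul, map_natCast, h2a, h2b] at this
    refine mul_right_cancel₀ hg0 ?_
    linear_combination this + hrc
  have hσ₁S : σ₁ S = s₀ + s₁ * ra - s₂ * rb - s₃ * rc := by
    rw [hS]
    simp only [map_add, map_mul, map_intCast, h1a, h1b, h1c]
    ring
  have hσ₂S : σ₂ S = s₀ - s₁ * ra + s₂ * rb - s₃ * rc := by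
    rw [hS]
    simp only [map_add, map_mul, map_intCast, h2a, h2b, h2c]
    ring
  -- the partial norms
  have hbc : rb * rc = b / (Int.gcd a b : F) * ra := by
    field_simp
    linear_combination rb * hrc + ra * hrb
  have hac : ra * rc = a / (Int.gcd a b : F) * rb := by
    field_simp
    linear_combination ra * hrc + rb * hra
  have hT₁ : S * σ₁ S ∈ ℚ⟮ra⟯ := by
    -- Expansion of `(s₀ + s₁√a)² - (s₂√b + s₃√c)²`, with `√b√c = (b/g)√a`. The other two products
    -- are treated alike.
    refine mem_adjoin_simple_of_eq (s₀ ^ 2 + s₁ ^ 2 * a - s₂ ^ 2 * b - s₃ ^ 2 * c)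
      (2 * s₀ * s₁ - 2 * s₂ * s₃ * (b / (Int.gcd a b : ℚ))) ?_
    rw [hσ₁S, hS]
    push_cast
    linear_combination s₁ ^ 2 * hra - s₂ ^ 2 * hrb - s₃ ^ 2 * hrc2 - 2 * s₂ * s₃ * hbc
  have hT₂ : S * σ₂ S ∈ ℚ⟮rb⟯ := by
    refine mem_adjoin_simple_of_eq (s₀ ^ 2 + s₂ ^ 2 * b - s₁ ^ 2 * a - s₃ ^ 2 * c)
      (2 * s₀ * s₂ - 2 * s₁ * s₃ * (a / (Int.gcd a b : ℚ))) ?_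
    rw [hσ₂S, hS]
    push_cast
    linear_combination -s₁ ^ 2 * hra + s₂ ^ 2 * hrb - s₃ ^ 2 * hrc2 - 2 * s₁ * s₃ * hac
  have hT₃ : σ₁ S * σ₂ S ∈ ℚ⟮rc⟯ := by
    refine mem_adjoin_simple_of_eq (s₀ ^ 2 + s₃ ^ 2 * c - s₂ ^ 2 * b - s₁ ^ 2 * a)
      (2 * s₁ * s₂ * (Int.gcd a b : ℚ) - 2 * s₀ * s₃) ?_
    rw [hσ₁S, hσ₂S]
    push_cast
    linear_combination -s₁ ^ 2 * hra - s₂ ^ 2 * hrb + s₃ ^ 2 * hrc2 - 2 * s₁ * s₂ * hrc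
  -- the integers `√a`, `√b`, `√c`
  obtain ⟨ρ, hρ⟩ := exists_ringOfIntegers_coe_eq hra
  obtain ⟨τ, hτ⟩ := exists_ringOfIntegers_coe_eq hrb
  obtain ⟨κ, hκ⟩ := exists_ringOfIntegers_coe_eq hrc2
  have hρ2 : ρ ^ 2 = a := RingOfIntegers.ext (by simp [hρ, hra])
  have hτ2 : τ ^ 2 = b := RingOfIntegers.ext (by simp [hτ, hrb])
  have hκg : κ * ((Int.gcd a b : ℤ) : 𝓞 F) = ρ * τ :=
    RingOfIntegers.ext (by simp [hρ, hτ, hκ, hrc])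
  obtain ⟨α, hα⟩ := exists_ringOfIntegers_coe_eq (K := ℚ⟮ra⟯)
    (r := IntermediateField.AdjoinSimple.gen ℚ ra) (a := a) (Subtype.ext (by simp [hra]))
  obtain ⟨β, hβ⟩ := exists_ringOfIntegers_coe_eq (K := ℚ⟮rb⟯)
    (r := IntermediateField.AdjoinSimple.gen ℚ rb) (a := b) (Subtype.ext (by simp [hrb]))
  obtain ⟨γ, hγ⟩ := exists_ringOfIntegers_coe_eq (K := ℚ⟮rc⟯)
    (r := IntermediateField.AdjoinSimple.gen ℚ rc) (a := c) (Subtype.ext (by simp [hrc2]))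
  have hα' : ((α : ℚ⟮ra⟯) : F) = ra := by rw [hα]; rfl
  have hβ' : ((β : ℚ⟮rb⟯) : F) = rb := by rw [hβ]; rfl
  have hγ' : ((γ : ℚ⟮rc⟯) : F) = rc := by rw [hγ]; rfl
  -- the four places
  have place (A' B' C' : ℤ) (hA' : A' ^ 2 ≡ a [ZMOD p]) (hB' : B' ^ 2 ≡ b [ZMOD p])
      (hC' : C' * (Int.gcd a b : ℤ) ≡ A' * B' [ZMOD p]) :
      ∃ P : HeightOneSpectrum (𝓞 F), (p : 𝓞 F) ∈ P.asIdeal ∧ ρ - A' ∈ P.asIdeal ∧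
        τ - B' ∈ P.asIdeal ∧ κ - C' ∈ P.asIdeal := by
    obtain ⟨P, hP, hPρ, hPτ⟩ := exists_heightOneSpectrum_of_sq_roots hρ2 hτ2
      (RingOfIntegers.mapRingEquiv σ₁.toRingEquiv) (RingOfIntegers.mapRingEquiv σ₂.toRingEquiv)
      (RingOfIntegers.ext (by simp [hρ, h1a])) (RingOfIntegers.ext (by simp [hτ, h1b]))
      (RingOfIntegers.ext (by simp [hρ, h2a])) hA' hB'
    exact ⟨P, hP, hPρ, hPτ, sub_mem_of_mul_eq_mul hP hκg hpg hC' hPρ hPτ⟩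
  -- The signs of `A` and `B` are free; the sign of `C` is their product, as `Cg ≡ AB` requires.
  obtain ⟨P₁, h1, h1ρ, h1τ, h1κ⟩ := place A B C hA hB hABC
  obtain ⟨P₂, h2, h2ρ, h2τ, h2κ⟩ := place A (-B) (-C) hA (by rwa [neg_sq])
    (by simpa using hABC.neg)
  obtain ⟨P₃, h3, h3ρ, h3τ, h3κ⟩ := place (-A) B (-C) (by rwa [neg_sq]) hB
    (by simpa using hABC.neg)
  obtain ⟨P₄, h4, h4ρ, h4τ, h4κ⟩ := place (-A) (-B) C (by rwa [neg_sq]) (by rwa [neg_sq])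
    (by simpa using hABC)
  have n12 : P₁ ≠ P₂ := ne_of_sub_mem_of_add_mem h1 hB2 h1τ (by simpa using h2τ)
  have n13 : P₁ ≠ P₃ := ne_of_sub_mem_of_add_mem h1 hA2 h1ρ (by simpa using h3ρ)
  have n14 : P₁ ≠ P₄ := ne_of_sub_mem_of_add_mem h1 hA2 h1ρ (by simpa using h4ρ)
  have n23 : P₂ ≠ P₃ := ne_of_sub_mem_of_add_mem h2 hA2 h2ρ (by simpa using h3ρ)
  have n24 : P₂ ≠ P₄ := ne_of_sub_mem_of_add_mem h2 hA2 h2ρ (by simpa using h4ρ)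
  have n34 : P₃ ≠ P₄ := ne_of_sub_mem_of_add_mem h3 hB2 h3τ (by simpa using h4τ)
  classical
  let s : Finset (HeightOneSpectrum (𝓞 F)) := {P₁, P₂, P₃, P₄}
  have hs4 : s.card = 4 := by simp [s, n12, n13, n14, n23, n24, n34]
  have hs : ∀ P ∈ s, (p : 𝓞 F) ∈ P.asIdeal := by simp [s, h1, h2, h3, h4]
  have hcard : Module.finrank ℚ F ≤ s.card := hs4 ▸ finrank_le_four hra hrb hF
  have hmem (P : HeightOneSpectrum (𝓞 F)) : P ∈ s ↔ (p : 𝓞 F) ∈ P.asIdeal :=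
    ⟨hs P, mem_of_finrank_le_card hpp hs hcard⟩
  have hval (P : HeightOneSpectrum (𝓞 F)) (hP : P ∈ s) : P.valuation F p = WithZero.exp (-1) :=
    valuation_eq_exp_neg_one hpp hs hcard hP
  have hset : {P : HeightOneSpectrum (𝓞 F) | (p : 𝓞 F) ∈ P.asIdeal} = (s : Set _) := by
    ext P
    simp [← hmem]
  refine ⟨by rw [hset, Set.ncard_coe_finset, hs4], ?_⟩
  -- the six places of the quadratic subfields
  have hA2' : ¬ (p : ℤ) ∣ 2 * -A := by rwa [mul_neg, dvd_neg]
  have hB2' : ¬ (p : ℤ) ∣ 2 * -B := by rwa [mul_neg, dvd_neg]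
  have hC2' : ¬ (p : ℤ) ∣ 2 * -C := by rwa [mul_neg, dvd_neg]
  -- Each prime needs a second place where the root has the opposite residue: `P₃` flips `A`, while
  -- `P₂` flips `B` and `C`.
  obtain ⟨𝔭₁₁, e11, o11⟩ := exists_heightOneSpectrum_adjoin hra hpp hA2 ρ hρ α hα' h1 h1ρ h3
    (by simpa using h3ρ)
  obtain ⟨𝔭₁₂, e12, o12⟩ := exists_heightOneSpectrum_adjoin hra hpp hA2' ρ hρ α hα' h3 h3ρ h1
    (by simpa [← sub_eq_add_neg] using h1ρ)
  obtain ⟨𝔭₂₁, e21, o21⟩ := exists_heightOneSpectrum_adjoin hrb hpp hB2 τ hτ β hβ' h1 h1τ h2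
    (by simpa using h2τ)
  obtain ⟨𝔭₂₂, e22, o22⟩ := exists_heightOneSpectrum_adjoin hrb hpp hB2' τ hτ β hβ' h2 h2τ h1
    (by simpa [← sub_eq_add_neg] using h1τ)
  obtain ⟨𝔭₃₁, e31, o31⟩ := exists_heightOneSpectrum_adjoin hrc2 hpp hC2 κ hκ γ hγ' h1 h1κ h2
    (by simpa using h2κ)
  obtain ⟨𝔭₃₂, e32, o32⟩ := exists_heightOneSpectrum_adjoin hrc2 hpp hC2' κ hκ γ hγ' h2 h2κ h1
    (by simpa [← sub_eq_add_neg] using h1κ)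
  have hσ₁0 : σ₁ S ≠ 0 := by simpa using hS0
  have hσ₂0 : σ₂ S ≠ 0 := by simpa using hS0
  have v1 := hval P₁ (by simp [s])
  have v2 := hval P₂ (by simp [s])
  have v3 := hval P₃ (by simp [s])
  have v4 := hval P₄ (by simp [s])
  refine ⟨α, β, γ, 𝔭₁₁, 𝔭₁₂, 𝔭₂₁, 𝔭₂₂, 𝔭₃₁, 𝔭₃₂, ⟨_, hT₁⟩, ⟨_, hT₂⟩, ⟨_, hT₃⟩, hα', hβ', hγ',
    e11, by simpa using e12, e21, by simpa using e22, e31, by simpa using e32, rfl, rfl, rfl, ?_⟩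
  have key : (∀ P : HeightOneSpectrum (𝓞 F), (p : 𝓞 F) ∈ P.asIdeal →
      hilbertSymbol (P.adicCompletion F) (-1) (algebraMap F (P.adicCompletion F) S) = 1) ↔
      ∀ P ∈ s, Even (ordAt P S) := by
    refine forall_congr' fun P => ?_
    rw [hmem]
    refine forall_congr' fun hP => ?_
    exact hilbertSymbol_neg_one_eq_one_iff P p hp hP
      (absNorm_eq_of_finrank_le_card hpp hs hcard ((hmem P).2 hP)) hS0
  rw [key]
  simp only [s, Finset.forall_mem_insert, Finset.mem_singleton, forall_eq,
    even_ordAt_iff_four_dvd _ hS0 hσ₁0 hσ₂0]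
  -- The four sums correspond to `P₁`, `P₂`, `P₃`, `P₄`; the prime of `F₃` below is `𝔭₃₁` when the
  -- signs of `A` and `B` agree, and `𝔭₃₂` otherwise.
  refine and_congr ?_ (and_congr ?_ (and_congr ?_ ?_))
  · rw [o11 P₁ h1 h1ρ v1, o21 P₁ h1 h1τ v1, o31 P₁ h1 h1κ v1]
  · rw [o11 P₂ h2 h2ρ v2, o22 P₂ h2 h2τ v2, o32 P₂ h2 h2κ v2]
  · rw [o12 P₃ h3 h3ρ v3, o21 P₃ h3 h3τ v3, o32 P₃ h3 h3κ v3]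
  · rw [o12 P₄ h4 h4ρ v4, o22 P₄ h4 h4τ v4, o31 P₄ h4 h4κ v4]
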